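/- Let $V_1,V_2,V_3$ be vector spaces over a field $\mathbb F$, let $n\ge 0$ be an integer, and let $x_a=x_{a,1}\otimes x_{a,2}\otimes x_{a,3}\in V_1\otimes V_2\otimes V_3$ ($a\in[n]=\{1,\dots,n\}$) be product tensors, that is, non-zero tensors of this form, with fixed factors $x_{a,j}\in V_j$. The k-rank of a family of vectors $(u_i)_{i\in I}$, $I$ finite, is the largest $k\le |I|$ such that $\dim\operatorname{span}\{u_i:i\in S\}=k$ for every $S\subseteq I$ with $|S|=k$. Let $k_1=\operatorname{k-rank}(x_{1,1},\dots,x_{n,1})$ and $d_1=\dim\operatorname{span}\{x_{a,1}:a\in[n]\}$. For $\alpha\in\mathbb F^n$ let $\omega(\alpha)$ be the number of non-zero entries of $\alpha$. The rank of a tensor is the least number of product tensors summing to it. Condition U: $k_1\ge 2$, and for all $\alpha\in\mathbb F^n$, $$\operatorname{rank}\Big[\sum_{a\in[n]}\alpha_a\,x_{a,2}\otimes x_{a,3}\Big]\ \ge\ \min\{\omega(\alpha),\,n-d_1+2\}.$$ Echelon condition: there is a permutation $\tau\in S_n$ for which the matrix $X_1^\tau$ with columns $x_{\tau(1),1},\dots,x_{\tau(n),1}$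 (in coordinates with respect to any fixed finite linearly independent family in $V_1$ whose span contains all $x_{a,1}$) has reduced row echelon form $Y=[\,I_{d_1}\mid Z\,]$ for some $d_1\times(n-d_1)$ matrix $Z$ (zero rows being omitted), and for each integer $a$ with $1\le a\le d_1-1$ the columns of the submatrix of $Y$ with rows $\{a,\dots,d_1\}$ and columns $\{a,\dots,n\}$ have k-rank at least $2$. Then the following hold. (i) The echelon condition holds if and only if there is a permutation $\tau\in S_n$ such that for each integer $a$ with $1\le a\le d_1-1$ there is a linear operator $\Pi_a:V_1\to V_1$ with $\Pi_a x_{\tau(b),1}=0$ for all $1\le b\le a-1$ and $\operatorname{k-rank}(\Pi_a x_{\tau(a),1},\dots,\Pi_a x_{\tau(n),1})\ge 2$. (ii) If Condition U and the echelon condition hold, then $\sum_{a\in[n]}x_a$ is a unique tensor rank decomposition: whenever $\sum_{a\in[n]}x_a=\sum_{a\in[r]}y_a$ with $r\le n$ and product tensors $y_1,\dots,y_r\in V_1\otimes V_2\otimes V_3$, it holds that $r=n$ and $\{x_a:a\in[n]\}=\{y_a:a\in[n]\}$ as multisets. -/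

import Mathlib

open scoped TensorProduct

noncomputable section

namespace TensorUniqueness

/-- The dimension of the span of a family of vectors. -/
def dimSpan (F : Type*) {V ι : Type*} [Field F] [AddCommGroup V] [Module F V] (u : ι → V) : ℕ :=
  Module.finrank F (Submodule.span F (Set.range u))

/-- The Kruskal rank of a finite family of vectors: the largest `k` (at most the number of vectors)
such that any `k` members of the family span a `k`-dimensional space. The set below contains `0`
and is bounded, so the supremum is a maximum. -/
def kRank (F : Type*) {V ι : Type*} [Field F] [AddCommGroup V] [Module F V] [Fintype ι]
    (u : ι → V) : ℕ :=
  sSup {k : ℕ | k ≤ Fintype.card ι ∧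
    ∀ S : Finset ι, S.card = k → Module.finrank F (Submodule.span F (u '' (S : Set ι))) = k}

/-- Nonzero product tensors in `V ⊗ W`. -/
def IsProductTensor₂ {F V W : Type*} [Field F] [AddCommGroup V] [Module F V]
    [AddCommGroup W] [Module F W] (z : V ⊗[F] W) : Prop :=
  z ≠ 0 ∧ ∃ (v : V) (w : W), z = v ⊗ₜ[F] w

/-- Nonzero product tensors in `V₁ ⊗ V₂ ⊗ V₃`. -/
def IsProductTensor₃ {F V₁ V₂ V₃ : Type*} [Field F] [AddCommGroup V₁] [Module F V₁]
    [AddCommGroup V₂] [Module F V₂] [AddCommGroup V₃] [Module F V₃]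
    (z : V₁ ⊗[F] V₂ ⊗[F] V₃) : Prop :=
  z ≠ 0 ∧ ∃ (v₁ : V₁) (v₂ : V₂) (v₃ : V₃), z = v₁ ⊗ₜ[F] v₂ ⊗ₜ[F] v₃

/-- The rank of a tensor in `V ⊗ W`: the least number of product tensors summing to it. -/
def tensorRank₂ {F V W : Type*} [Field F] [AddCommGroup V] [Module F V]
    [AddCommGroup W] [Module F W] (t : V ⊗[F] W) : ℕ :=
  sInf {r : ℕ | ∃ z : Fin r → V ⊗[F] W, (∀ i, IsProductTensor₂ (z i)) ∧ t = ∑ i, z i}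

/-- `∑ a, x a` is a unique tensor rank decomposition: every decomposition of the same tensor into
`r ≤ n` product tensors has `r = n` and consists of the same product tensors, as multisets. -/
def IsUniqueTensorRankDecomposition {F V₁ V₂ V₃ : Type*} [Field F]
    [AddCommGroup V₁] [Module F V₁] [AddCommGroup V₂] [Module F V₂]
    [AddCommGroup V₃] [Module F V₃] {n : ℕ} (x : Fin n → V₁ ⊗[F] V₂ ⊗[F] V₃) : Prop :=
  (∀ a, IsProductTensor₃ (x a)) ∧
  ∀ (r : ℕ) (y : Fin r → V₁ ⊗[F] V₂ ⊗[F] V₃), r ≤ n → (∀ a, IsProductTensor₃ (y a)) →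
    ∑ a, x a = ∑ a, y a →
      r = n ∧ Multiset.map x Finset.univ.val = Multiset.map y Finset.univ.val

/-- Condition U: the first factors have Kruskal rank at least two, and
`rank (∑ α_a x_{a,2} ⊗ x_{a,3}) ≥ min {ω(α), n - d₁ + 2}` for all `α`, where `ω(α)` is the number
of nonzero entries of `α` and `d₁ ≤ n` is the dimension of the span of the first factors. -/
def ConditionU {F V₁ V₂ V₃ : Type*} [Field F]
    [AddCommGroup V₁] [Module F V₁] [AddCommGroup V₂] [Module F V₂]
    [AddCommGroup V₃] [Module F V₃] {n : ℕ}
    (x₁ : Fin n → V₁) (x₂ : Fin n → V₂) (x₃ : Fin n → V₃) : Prop :=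
  2 ≤ kRank F x₁ ∧
  ∀ α : Fin n → F,
    min (Function.support α).ncard (n - dimSpan F x₁ + 2) ≤
      tensorRank₂ (∑ a, α a • (x₂ a ⊗ₜ[F] x₃ a))

/-- Reduced row echelon form: the first `r` rows have leading entry `1` in strictly increasing
pivot columns `p 0 < p 1 < ⋯`, each pivot is the only nonzero entry of its column, and the
remaining rows vanish. -/
def IsReducedRowEchelon {F : Type*} [Field F] {m n : ℕ} (Y : Matrix (Fin m) (Fin n) F) : Prop :=
  ∃ (r : ℕ) (hr : r ≤ m) (p : Fin r → Fin n), StrictMono p ∧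
    (∀ k : Fin r, Y (Fin.castLE hr k) (p k) = 1) ∧
    (∀ (k : Fin r) (j : Fin n), j < p k → Y (Fin.castLE hr k) j = 0) ∧
    (∀ (k : Fin r) (i : Fin m), i ≠ Fin.castLE hr k → Y i (p k) = 0) ∧
    (∀ (i : Fin m) (j : Fin n), r ≤ (i : ℕ) → Y i j = 0)

/-- `Y` is the reduced row echelon form of `X`. -/
def IsReducedRowEchelonFormOf {F : Type*} [Field F] {m n : ℕ}
    (Y X : Matrix (Fin m) (Fin n) F) : Prop :=
  IsReducedRowEchelon Y ∧ ∃ P : Matrix (Fin m) (Fin m) F, IsUnit P ∧ P * X = Y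

/-- The echelon condition on a matrix `X` of rank `d`: for some ordering `τ` of its columns the
reduced row echelon form is `[I_d | Z]` (followed by zero rows if `X` has more than `d` rows), and
for each `a = 1, …, d - 1` the columns of the submatrix with rows `a, …, d` and columns `a, …, n`
have Kruskal rank at least two. Indices in the code start at `0`. -/
def EchelonCondition {F : Type*} [Field F] {m n : ℕ} (d : ℕ)
    (X : Matrix (Fin m) (Fin n) F) : Prop :=
  ∃ (τ : Equiv.Perm (Fin n)) (Y : Matrix (Fin m) (Fin n) F),
    IsReducedRowEchelonFormOf Y (X.submatrix id τ) ∧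
    (∀ (i : Fin m) (j : Fin n), (j : ℕ) < d → Y i j = if (i : ℕ) = (j : ℕ) then 1 else 0) ∧
    (∀ (i : Fin m) (j : Fin n), d ≤ (i : ℕ) → Y i j = 0) ∧
    ∀ a : ℕ, a + 1 < d →
      2 ≤ kRank F (fun (j : {j : Fin n // a ≤ (j : ℕ)})
        (i : {i : Fin m // a ≤ (i : ℕ) ∧ (i : ℕ) < d}) => Y i j)

/-- The coordinate-free version of the echelon condition: for some ordering `τ`, for each
`a = 1, …, d₁ - 1` some linear operator kills the first `a - 1` vectors and maps the remaining ones
to a family of Kruskal rank at least two. Indices in the code start at `0`. -/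
def InvariantCondition {F V₁ : Type*} [Field F] [AddCommGroup V₁] [Module F V₁] {n : ℕ}
    (x₁ : Fin n → V₁) : Prop :=
  ∃ τ : Equiv.Perm (Fin n), ∀ a : ℕ, a + 1 < dimSpan F x₁ →
    ∃ T : V₁ →ₗ[F] V₁,
      (∀ b : Fin n, (b : ℕ) < a → T (x₁ (τ b)) = 0) ∧
      2 ≤ kRank F (fun j : {j : Fin n // a ≤ (j : ℕ)} => T (x₁ (τ j)))

end TensorUniqueness

end

/-! Uniqueness. Contracting the first factor with a functional `f` turns an equality of two
decompositions into `∑ f(x_{a,1}) x_{a,2} ⊗ x_{a,3} = ∑ f(y_{a,1}) y_{a,2} ⊗ y_{a,3}`. The right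
side has rank at most the number of `y_{a,1}` off the hyperplane `f = 0`. If that number is below `n
- d₁ + 2`, Condition U bounds the number of `x_{a,1}` off the hyperplane by it. This is the
hypothesis of Kruskal's permutation lemma (`exists_perm_of_card_hyperplane_le`), so the first
factors agree up to order and scaling.

With equal first factors, each row of the echelon form gives a relation between the remaining
factors (`ConditionU.tmul_eq`). The last two nonzero rows involve only the last `n - d₁ + 2`
columns. There Condition U makes the second factors, and likewise the third, linearly independent,
and the echelon condition makes the columns pairwise non-proportional; such a pencil determines its
terms (`tmul_eq_of_pencil_eq`). Every earlier pivot row then has a single undetermined term, its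
pivot.

Equivalence. Row reduction followed by projection to rows `a, …, d₁` is an operator as required.
Conversely, the operators force the first `d₁` vectors to be independent
(`linearIndependent_initial`). The echelon form consists of coordinates in that basis, and a linear
map carries the columns of each submatrix to the operator's images. -/

noncomputable section

namespace TensorUniqueness

/-! ### Kruskal rank at least two, and dual families -/

section KruskalRank

variable {F V W ι : Type*} [Field F] [AddCommGroup V] [Module F V] [AddCommGroup W] [Module F W]

/-- A family has Kruskal rank at least two iff it has at least two members and any two of them are
linearly independent. -/
theorem two_le_kRank_iff [Fintype ι] (u : ι → V) :
    2 ≤ kRank F u ↔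
      2 ≤ Fintype.card ι ∧ ∀ i j, i ≠ j → LinearIndependent F ![u i, u j] := by
  classical
  set K : Set ℕ := {k : ℕ | k ≤ Fintype.card ι ∧
    ∀ S : Finset ι, S.card = k →
      Module.finrank F (Submodule.span F (u '' (S : Set ι))) = k} with hK
  have hbdd : BddAbove K := ⟨Fintype.card ι, fun k hk => hk.1⟩
  have hne : K.Nonempty := ⟨0, Nat.zero_le _, fun S hS => by
    obtain rfl := Finset.card_eq_zero.1 hS
    rw [Finset.coe_empty, Set.image_empty, Submodule.span_empty, finrank_bot]⟩
  have hmem : kRank F u ∈ K := Nat.sSup_mem hne hbdd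
  constructor
  · intro h
    refine ⟨h.trans hmem.1, fun i j hij => ?_⟩
    -- The supremum is attained, so enlarging the pair to a set of exactly that size gives an
    -- independent family containing it.
    obtain ⟨S, hS, hcard⟩ := Finset.exists_superset_card_eq (s := {i, j})
      ((Finset.card_pair hij).le.trans h) hmem.1
    have hi : i ∈ S := hS (by simp)
    have hj : j ∈ S := hS (by simp)
    have hind : LinearIndependent F (fun s : S => u s) := by
      rw [linearIndependent_iff_card_eq_finrank_span, Set.finrank]
      have hr : Set.range (fun s : S => u s) = u '' (S : Set ι) := by
        ext v
        simp
      rw [hr, hmem.2 S hcard, Fintype.card_coe, hcard]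
    have hinj : Function.Injective ![(⟨i, hi⟩ : S), ⟨j, hj⟩] := by
      intro a b hab
      fin_cases a <;> fin_cases b <;> simp_all
    have := hind.comp _ hinj
    convert this using 1
    ext a
    fin_cases a <;> rfl
  · rintro ⟨hc, h⟩
    refine le_csSup hbdd ⟨hc, fun S hS => ?_⟩
    obtain ⟨i, j, hij, rfl⟩ := Finset.card_eq_two.1 hS
    have := finrank_span_eq_card (h i j hij)
    rwa [Matrix.range_cons, Matrix.range_cons, Matrix.range_empty, Set.union_empty,
      Set.singleton_union, Fintype.card_fin, ← Set.image_pair, ← Finset.coe_pair] at this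

theorem linearIndependent_pair_of_map {u v : V} (f : V →ₗ[F] W)
    (h : LinearIndependent F ![f u, f v]) : LinearIndependent F ![u, v] := by
  rw [LinearIndependent.pair_iff] at h ⊢
  intro s t hst
  exact h s t (by rw [← map_smul, ← map_smul, ← map_add, hst, map_zero])

theorem linearIndependent_pair_map {u v : V} (f : V →ₗ[F] W) (hf : Function.Injective f)
    (h : LinearIndependent F ![u, v]) : LinearIndependent F ![f u, f v] := by
  rw [LinearIndependent.pair_iff] at h ⊢
  intro s t hst
  exact h s t (hf (by rw [map_add, map_smul, map_smul, hst, map_zero]))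

/-- A linearly independent family has a dual family of functionals. -/
theorem exists_dual_family [DecidableEq ι] {u : ι → V} (hu : LinearIndependent F u) :
    ∃ g : ι → V →ₗ[F] F, ∀ i j, g i (u j) = if i = j then 1 else 0 := by
  obtain ⟨φ, hφ⟩ := LinearMap.exists_leftInverse_of_injective (Finsupp.linearCombination F u)
    (LinearMap.ker_eq_bot.2 hu)
  refine ⟨fun i => Finsupp.lapply i ∘ₗ φ, fun i j => ?_⟩
  have := LinearMap.congr_fun hφ (Finsupp.single j 1)
  simp only [LinearMap.comp_apply, Finsupp.linearCombination_single, one_smul,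
    LinearMap.id_apply] at this
  simp [this, Finsupp.single_apply, eq_comm]

/-- Expansion of a vector in the span of a family along a dual family. -/
theorem eq_sum_of_mem_span [Fintype ι] [DecidableEq ι] {u : ι → V} {g : ι → V →ₗ[F] F}
    (hg : ∀ i j, g i (u j) = if i = j then 1 else 0) {v : V}
    (hv : v ∈ Submodule.span F (Set.range u)) : v = ∑ i, g i v • u i := by
  obtain ⟨c, rfl⟩ := (Submodule.mem_span_range_iff_exists_fun F).1 hv
  simp [map_sum, hg]

end KruskalRank

/-! ### Rank bounds for sums of product tensors -/

section TensorRank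

variable {F V W ι : Type*} [Field F] [AddCommGroup V] [Module F V] [AddCommGroup W] [Module F W]

theorem tensorRank₂_sum_le (S : Finset ι) (v : ι → V) (w : ι → W) :
    tensorRank₂ (∑ i ∈ S, v i ⊗ₜ[F] w i) ≤ S.card := by
  classical
  -- Product tensors are nonzero by definition, so vanishing terms must be discarded.
  set R := S.filter (fun i => v i ⊗ₜ[F] w i ≠ 0) with hR
  refine le_trans (Nat.sInf_le ?_) (Finset.card_filter_le S (fun i => v i ⊗ₜ[F] w i ≠ 0))
  refine ⟨fun k => v (R.equivFin.symm k) ⊗ₜ[F] w (R.equivFin.symm k), fun k => ?_, ?_⟩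
  · exact ⟨(Finset.mem_filter.1 (R.equivFin.symm k).2).2, _, _, rfl⟩
  · rw [R.equivFin.symm.sum_comp (fun i : R => v i ⊗ₜ[F] w i),
      Finset.sum_coe_sort R (fun i => v i ⊗ₜ[F] w i), hR, Finset.sum_filter_ne_zero]

theorem exists_eq_sum_erase_of_not_linearIndependent [Fintype ι] [DecidableEq ι] {v : ι → V}
    (h : ¬ LinearIndependent F v) :
    ∃ (b : ι) (c : ι → F), v b = ∑ i ∈ Finset.univ.erase b, c i • v i := by
  obtain ⟨g, hg, b, hb⟩ := Fintype.not_linearIndependent_iff.1 h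
  refine ⟨b, fun i => -(g b)⁻¹ * g i, ?_⟩
  rw [← Finset.add_sum_erase _ _ (Finset.mem_univ b)] at hg
  have h1 : g b • v b = -∑ i ∈ Finset.univ.erase b, g i • v i := eq_neg_of_add_eq_zero_left hg
  calc v b = (g b)⁻¹ • (g b • v b) := by rw [smul_smul, inv_mul_cancel₀ hb, one_smul]
    _ = _ := by
      rw [h1, smul_neg, Finset.smul_sum, ← Finset.sum_neg_distrib]
      exact Finset.sum_congr rfl fun i _ => by simp [smul_smul]

/-- If a sum of product tensors has rank at least the number of its terms, then the left factors
are linearly independent. -/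
theorem linearIndependent_left_of_card_le_tensorRank₂ [Fintype ι] (v : ι → V) (w : ι → W)
    (h : Fintype.card ι ≤ tensorRank₂ (∑ i, v i ⊗ₜ[F] w i)) : LinearIndependent F v := by
  classical
  by_contra hdep
  -- A dependence lets term `b` be absorbed into the right factors of the others, leaving one term
  -- fewer than the rank allows.
  obtain ⟨b, c, hvb⟩ := exists_eq_sum_erase_of_not_linearIndependent hdep
  have hsum : ∑ i, v i ⊗ₜ[F] w i =
      ∑ i ∈ Finset.univ.erase b, v i ⊗ₜ[F] (w i + c i • w b) := by
    rw [← Finset.add_sum_erase _ _ (Finset.mem_univ b)]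
    conv_lhs => rw [hvb]
    rw [TensorProduct.sum_tmul, ← Finset.sum_add_distrib]
    refine Finset.sum_congr rfl fun i _ => ?_
    rw [TensorProduct.tmul_add, TensorProduct.tmul_smul, TensorProduct.smul_tmul', add_comm]
  rw [hsum] at h
  have h2 := h.trans (tensorRank₂_sum_le _ _ _)
  rw [Finset.card_erase_of_mem (Finset.mem_univ b), Finset.card_univ] at h2
  have := Fintype.card_pos_iff.2 ⟨b⟩
  omega

/-- If a sum of product tensors has rank at least the number of its terms, then the right factors
are linearly independent. -/
theorem linearIndependent_right_of_card_le_tensorRank₂ [Fintype ι] (v : ι → V) (w : ι → W)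
    (h : Fintype.card ι ≤ tensorRank₂ (∑ i, v i ⊗ₜ[F] w i)) : LinearIndependent F w := by
  classical
  by_contra hdep
  obtain ⟨b, c, hwb⟩ := exists_eq_sum_erase_of_not_linearIndependent hdep
  have hsum : ∑ i, v i ⊗ₜ[F] w i =
      ∑ i ∈ Finset.univ.erase b, (v i + c i • v b) ⊗ₜ[F] w i := by
    rw [← Finset.add_sum_erase _ _ (Finset.mem_univ b)]
    conv_lhs => rw [hwb]
    rw [TensorProduct.tmul_sum, ← Finset.sum_add_distrib]
    refine Finset.sum_congr rfl fun i _ => ?_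
    rw [TensorProduct.add_tmul, TensorProduct.smul_tmul, add_comm]
  rw [hsum] at h
  have h2 := h.trans (tensorRank₂_sum_le _ _ _)
  rw [Finset.card_erase_of_mem (Finset.mem_univ b), Finset.card_univ] at h2
  have := Fintype.card_pos_iff.2 ⟨b⟩
  omega

end TensorRank

/-! ### Kruskal's permutation lemma -/

section Permutation

open scoped Classical in
/-- The flat-counting step of Kruskal's permutation lemma: if every hyperplane containing enough of
the `y`s contains at least as many `x`s as `y`s, then so does every proper subspace spanned by
`y`s. -/
theorem card_mem_flat_le {F V ι : Type*} [Field F] [AddCommGroup V] [Module F V] [Fintype ι]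
    (x y : ι → V) (hxy : ∀ a, x a ∈ Submodule.span F (Set.range y))
    (H : ∀ f : V →ₗ[F] F, dimSpan F x ≤ (Finset.univ.filter fun j => f (y j) = 0).card + 1 →
      (Finset.univ.filter fun j => f (y j) = 0).card ≤
        (Finset.univ.filter fun a => f (x a) = 0).card)
    (W : Submodule F V) (hW : W = Submodule.span F (y '' {j | y j ∈ W}))
    (hproper : ∃ j, y j ∉ W) :
    (Finset.univ.filter fun j => y j ∈ W).card ≤ (Finset.univ.filter fun a => x a ∈ W).card := by
  induction hk : (Finset.univ.filter fun j => y j ∉ W).card using Nat.strong_induction_on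
    generalizing W with
  | _ k ih =>
  obtain ⟨j₀, hj₀⟩ := hproper
  have hWY : W ≤ Submodule.span F (Set.range y) := by
    rw [hW]
    exact Submodule.span_mono (Set.image_subset_range _ _)
  have hcover : ∀ u v : V, v ∉ W → v ∈ W ⊔ Submodule.span F {u} →
      W ⊔ Submodule.span F {v} = W ⊔ Submodule.span F {u} := by
    intro u v hv hvu
    refine le_antisymm (sup_le le_sup_left ((Submodule.span_singleton_le_iff_mem _ _).2 hvu))
      (sup_le le_sup_left ((Submodule.span_singleton_le_iff_mem _ _).2 ?_))
    obtain ⟨w, hw, z, hz, rfl⟩ := Submodule.mem_sup.1 hvu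
    obtain ⟨c, rfl⟩ := Submodule.mem_span_singleton.1 hz
    have hc : c ≠ 0 := by
      rintro rfl
      exact hv (by simpa using hw)
    have hu : -(c⁻¹ • w) + c⁻¹ • (w + c • u) = u := by
      rw [smul_add, smul_smul, inv_mul_cancel₀ hc, one_smul]
      abel
    have hmem : -(c⁻¹ • w) + c⁻¹ • (w + c • u) ∈ W ⊔ Submodule.span F {w + c • u} :=
      Submodule.add_mem_sup (W.neg_mem (W.smul_mem _ hw))
        (Submodule.smul_mem _ _ (Submodule.mem_span_singleton_self _))
    rwa [hu] at hmem
  -- The flats covering `W`: they partition the `y`s outside `W`, and each contains strictly more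
  -- `y`s, so induction applies to the proper ones.
  set 𝓗 : Finset (Submodule F V) := (Finset.univ.filter fun j => y j ∉ W).image
    (fun j => W ⊔ Submodule.span F {y j}) with h𝓗
  have hj₀mem : W ⊔ Submodule.span F {y j₀} ∈ 𝓗 :=
    Finset.mem_image_of_mem _ (by simp [hj₀])
  -- With a single cover, `W` is a hyperplane of the span of the `y`s, and its at least `dim W ≥
  -- dimSpan F x - 1` members `y j` make `H` applicable.
  by_cases htop : ∀ j, y j ∈ W ⊔ Submodule.span F {y j₀}
  · have hYeq : Submodule.span F (Set.range y) ≤ W ⊔ Submodule.span F {y j₀} :=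
      Submodule.span_le.2 (by rintro _ ⟨j, rfl⟩; exact htop j)
    obtain ⟨f, hf, hWf⟩ := Submodule.exists_le_ker_of_notMem hj₀
    have hker : ∀ v ∈ Submodule.span F (Set.range y), f v = 0 ↔ v ∈ W := by
      intro v hv
      refine ⟨fun h => ?_, fun h => hWf h⟩
      obtain ⟨w, hw, z, hz, rfl⟩ := Submodule.mem_sup.1 (hYeq hv)
      obtain ⟨c, rfl⟩ := Submodule.mem_span_singleton.1 hz
      have hw0 : f w = 0 := hWf hw
      have hc : c = 0 := by simpa [hw0, hf] using h
      simpa [hc] using hw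
    have hy : ∀ j, f (y j) = 0 ↔ y j ∈ W := fun j =>
      hker _ (Submodule.subset_span ⟨j, rfl⟩)
    have hx : ∀ a, f (x a) = 0 ↔ x a ∈ W := fun a => hker _ (hxy a)
    have hH := H f
    simp only [hy, hx] at hH
    refine hH ?_
    have hfdW : FiniteDimensional F W := by
      rw [hW]
      exact FiniteDimensional.span_of_finite F (Set.toFinite _)
    have h1 : dimSpan F x ≤ Module.finrank F (W ⊔ Submodule.span F {y j₀} : Submodule F V) := by
      refine Submodule.finrank_mono (Submodule.span_le.2 ?_)
      rintro _ ⟨a, rfl⟩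
      exact hYeq (hxy a)
    have h2 := Submodule.finrank_add_le_finrank_add_finrank W (Submodule.span F {y j₀})
    have h3 : Module.finrank F (Submodule.span F {y j₀}) ≤ 1 := by
      simpa using finrank_span_le_card (R := F) ({y j₀} : Set V)
    have h4 : Module.finrank F W ≤ (Finset.univ.filter fun j => y j ∈ W).card := by
      have h5 := finrank_span_finset_le_card (R := F)
        ((Finset.univ.filter fun j => y j ∈ W).image y)
      have h6 : (((Finset.univ.filter fun j => y j ∈ W).image y : Finset V) : Set V) =
          y '' {j | y j ∈ W} := by
        simp
      rw [h6, Set.finrank, ← hW] at h5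
      exact h5.trans Finset.card_image_le
    omega
  · push Not at htop
    obtain ⟨j₁, hj₁⟩ := htop
    have hj₁W : y j₁ ∉ W := fun h => hj₁ (Submodule.mem_sup_left h)
    have hj₁mem : W ⊔ Submodule.span F {y j₁} ∈ 𝓗 :=
      Finset.mem_image_of_mem _ (by simp [hj₁W])
    have hne : W ⊔ Submodule.span F {y j₀} ≠ W ⊔ Submodule.span F {y j₁} := by
      intro h
      exact hj₁ (h ▸ Submodule.mem_sup_right (Submodule.mem_span_singleton_self _))
    have hq : 2 ≤ 𝓗.card := Finset.one_lt_card.2 ⟨_, hj₀mem, _, hj₁mem, hne⟩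
    have hih : ∀ U ∈ 𝓗, (Finset.univ.filter fun j => y j ∈ U).card ≤
        (Finset.univ.filter fun a => x a ∈ U).card := by
      intro U hU
      obtain ⟨j, hj, rfl⟩ := Finset.mem_image.1 hU
      have hjW : y j ∉ W := (Finset.mem_filter.1 hj).2
      refine ih _ ?_ _ ?_ ?_ rfl
      · rw [← hk]
        refine Finset.card_lt_card ⟨?_, fun hsub => ?_⟩
        · intro i hi
          simp only [Finset.mem_filter, Finset.mem_univ, true_and] at hi ⊢
          exact fun h => hi (Submodule.mem_sup_left h)
        · have := hsub hj
          simp only [Finset.mem_filter, Finset.mem_univ, true_and] at this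
          exact this (Submodule.mem_sup_right (Submodule.mem_span_singleton_self _))
      · refine le_antisymm (sup_le ?_ ?_) (Submodule.span_le.2 ?_)
        · conv_lhs => rw [hW]
          exact Submodule.span_mono (Set.image_mono fun i hi => Submodule.mem_sup_left hi)
        · rw [Submodule.span_singleton_le_iff_mem]
          exact Submodule.subset_span
            ⟨j, Submodule.mem_sup_right (Submodule.mem_span_singleton_self _), rfl⟩
        · rintro _ ⟨i, hi, rfl⟩
          exact hi
      · by_contra hall
        push Not at hall
        exact hne ((hcover _ _ hj₀ (hall j₀)).trans (hcover _ _ hj₁W (hall j₁)).symm)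
    have hsplit : ∀ z : ι → V, ∀ U ∈ 𝓗, (Finset.univ.filter fun j => z j ∈ U).card =
        (Finset.univ.filter fun j => z j ∈ W).card +
        ((Finset.univ.filter fun j => z j ∉ W).filter
          fun j => W ⊔ Submodule.span F {z j} = U).card := by
      intro z U hU
      obtain ⟨j, hj, rfl⟩ := Finset.mem_image.1 hU
      rw [← Finset.card_union_of_disjoint]
      · congr 1
        ext i
        simp only [Finset.mem_filter, Finset.mem_univ, true_and, Finset.mem_union]
        constructor
        · intro h
          by_cases hi : z i ∈ W
          · exact Or.inl hi
          · exact Or.inr ⟨hi, hcover _ _ hi h⟩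
        · rintro (h | ⟨-, h⟩)
          · exact Submodule.mem_sup_left h
          · rw [← h]
            exact Submodule.mem_sup_right (Submodule.mem_span_singleton_self _)
      · rw [Finset.disjoint_left]
        intro i hi hi'
        exact (Finset.mem_filter.1 (Finset.mem_filter.1 hi').1).2 (Finset.mem_filter.1 hi).2
    have hysum : (Finset.univ.filter fun j => y j ∉ W).card =
        ∑ U ∈ 𝓗, ((Finset.univ.filter fun j => y j ∉ W).filter
          fun j => W ⊔ Submodule.span F {y j} = U).card :=
      Finset.card_eq_sum_card_fiberwise fun j hj => Finset.mem_image_of_mem _ hj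
    have hxsum : ∑ U ∈ 𝓗, ((Finset.univ.filter fun a => x a ∉ W).filter
          fun a => W ⊔ Submodule.span F {x a} = U).card ≤
        (Finset.univ.filter fun a => x a ∉ W).card := by
      rw [← Finset.card_biUnion]
      · exact Finset.card_le_card (Finset.biUnion_subset.2 fun U _ => Finset.filter_subset _ _)
      · intro U _ U' _ hUU'
        rw [Function.onFun, Finset.disjoint_left]
        intro a ha ha'
        exact hUU' ((Finset.mem_filter.1 ha).2.symm.trans (Finset.mem_filter.1 ha').2)
    -- Let `δ > 0` be the excess of `y`s over `x`s in `W`. Each cover then has at least `δ` more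
    -- `x`s than `y`s outside `W`, while in total there are at most `δ` more; with two or more
    -- covers this is impossible.
    by_contra hlt
    push Not at hlt
    have hx' := Finset.card_filter_add_card_filter_not (s := Finset.univ) (fun a => x a ∈ W)
    have hy' := Finset.card_filter_add_card_filter_not (s := Finset.univ) (fun a => y a ∈ W)
    have hfib : ∀ U ∈ 𝓗, ((Finset.univ.filter fun j => y j ∉ W).filter
          fun j => W ⊔ Submodule.span F {y j} = U).card +
          ((Finset.univ.filter fun j => y j ∈ W).card -
            (Finset.univ.filter fun a => x a ∈ W).card) ≤
        ((Finset.univ.filter fun a => x a ∉ W).filter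
          fun a => W ⊔ Submodule.span F {x a} = U).card := by
      intro U hU
      have h1 := hih U hU
      rw [hsplit x U hU, hsplit y U hU] at h1
      omega
    have htot := Finset.sum_le_sum hfib
    rw [Finset.sum_add_distrib, ← hysum, Finset.sum_const, smul_eq_mul] at htot
    have h2 := Nat.mul_le_mul_right ((Finset.univ.filter fun j => y j ∈ W).card -
            (Finset.univ.filter fun a => x a ∈ W).card) hq
    omega

open scoped Classical in
/-- Kruskal's permutation lemma: two families of the same size are equal up to order and scaling
if the first one is pairwise independent and contained in the span of the second one, and every
hyperplane containing enough of the `y`s contains at least as many `x`s as `y`s. -/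
theorem exists_perm_of_card_hyperplane_le {F V ι : Type*} [Field F] [AddCommGroup V] [Module F V]
    [Fintype ι] (x y : ι → V) (hx : ∀ a b, a ≠ b → LinearIndependent F ![x a, x b])
    (hd : 2 ≤ dimSpan F x) (hxy : ∀ a, x a ∈ Submodule.span F (Set.range y))
    (H : ∀ f : V →ₗ[F] F, dimSpan F x ≤ (Finset.univ.filter fun j => f (y j) = 0).card + 1 →
      (Finset.univ.filter fun j => f (y j) = 0).card ≤
        (Finset.univ.filter fun a => f (x a) = 0).card) :
    ∃ σ : Equiv.Perm ι, ∀ j, ∃ c : F, c ≠ 0 ∧ y j = c • x (σ j) := by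
  have hproper : ∀ v : V, ∃ j, y j ∉ Submodule.span F {v} := by
    intro v
    by_contra! hall
    have h1 : dimSpan F x ≤ Module.finrank F (Submodule.span F {v}) := by
      refine Submodule.finrank_mono (Submodule.span_le.2 ?_)
      rintro _ ⟨a, rfl⟩
      exact Submodule.span_le.2 (by rintro _ ⟨j, rfl⟩; exact hall j) (hxy a)
    have h2 : Module.finrank F (Submodule.span F {v}) ≤ 1 := by
      simpa using finrank_span_le_card (R := F) ({v} : Set V)
    omega
  have hcard : 2 ≤ Fintype.card ι := hd.trans (finrank_range_le_card x)
  have hx0 : ∀ a, x a ≠ 0 := by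
    intro a
    obtain ⟨b, hb⟩ := Fintype.exists_ne_of_one_lt_card (by omega) a
    exact (hx a b hb.symm).ne_zero 0
  have hy0 : ∀ j, y j ≠ 0 := by
    intro j hj
    have h := card_mem_flat_le x y hxy H ⊥
      (by
        symm
        rw [Submodule.span_eq_bot]
        rintro _ ⟨i, hi, rfl⟩
        exact hi)
      (by obtain ⟨i, hi⟩ := hproper 0; exact ⟨i, by simpa using hi⟩)
    have h0 : (Finset.univ.filter fun a => x a ∈ (⊥ : Submodule F V)) = ∅ := by
      simp [hx0]
    rw [h0, Finset.card_empty, Nat.le_zero, Finset.card_eq_zero, Finset.filter_eq_empty_iff] at h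
    exact h (Finset.mem_univ j) (by simp [hj])
  have hline : ∀ j, (Finset.univ.filter fun i => y i ∈ Submodule.span F {y j}).card ≤
      (Finset.univ.filter fun a => x a ∈ Submodule.span F {y j}).card := by
    intro j
    refine card_mem_flat_le x y hxy H _ (le_antisymm ?_ ?_) (hproper _)
    · rw [Submodule.span_singleton_le_iff_mem]
      exact Submodule.subset_span ⟨j, Submodule.mem_span_singleton_self _, rfl⟩
    · refine Submodule.span_le.2 ?_
      rintro _ ⟨i, hi, rfl⟩
      exact hi
  have hex : ∀ j, ∃ a, x a ∈ Submodule.span F {y j} := by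
    intro j
    have hpos : 0 < (Finset.univ.filter fun i => y i ∈ Submodule.span F {y j}).card :=
      Finset.card_pos.2 ⟨j, by simp [Submodule.mem_span_singleton_self]⟩
    obtain ⟨a, ha⟩ := Finset.card_pos.1 (hpos.trans_le (hline j))
    exact ⟨a, (Finset.mem_filter.1 ha).2⟩
  choose s hs using hex
  have hsc : ∀ j, ∃ c : F, c ≠ 0 ∧ y j = c • x (s j) := by
    intro j
    obtain ⟨c, hc⟩ := Submodule.mem_span_singleton.1 (hs j)
    have hc0 : c ≠ 0 := by
      rintro rfl
      exact hx0 (s j) (by rw [← hc, zero_smul])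
    exact ⟨c⁻¹, inv_ne_zero hc0, by rw [← hc, smul_smul, inv_mul_cancel₀ hc0, one_smul]⟩
  -- Two `y`s on one line would force two `x`s onto it, against pairwise independence.
  have hinj : Function.Injective s := by
    intro j k hjk
    by_contra hne
    have h2 : 2 ≤ (Finset.univ.filter fun i => y i ∈ Submodule.span F {y j}).card := by
      refine Finset.one_lt_card.2 ⟨j, by simp [Submodule.mem_span_singleton_self], k, ?_, hne⟩
      obtain ⟨c, -, hc⟩ := hsc k
      simp only [Finset.mem_filter, Finset.mem_univ, true_and]
      rw [hc, ← hjk]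
      exact Submodule.smul_mem _ _ (hs j)
    obtain ⟨a, ha, b, hb, hab⟩ := Finset.one_lt_card.1 (h2.trans (hline j))
    obtain ⟨c, hc⟩ := Submodule.mem_span_singleton.1 (Finset.mem_filter.1 ha).2
    obtain ⟨d, hd'⟩ := Submodule.mem_span_singleton.1 (Finset.mem_filter.1 hb).2
    have := LinearIndependent.pair_iff.1 (hx a b hab) d (-c)
      (by rw [← hc, ← hd', smul_smul, smul_smul, ← add_smul]; ring_nf; simp)
    exact hx0 b (by rw [← hd', this.1, zero_smul])
  exact ⟨Equiv.ofBijective s (Finite.injective_iff_bijective.1 hinj), hsc⟩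

end Permutation

/-! ### Pencils of tensors with independent factors -/

section Pencil

variable {F V W ι : Type*} [Field F] [AddCommGroup V] [Module F V] [AddCommGroup W] [Module F W]

/-- Contraction of the second factor of `V ⊗ W` with a functional. -/
def contractRight (g : W →ₗ[F] F) : V ⊗[F] W →ₗ[F] V :=
  (TensorProduct.rid F V).toLinearMap ∘ₗ LinearMap.lTensor V g

@[simp]
theorem contractRight_tmul (g : W →ₗ[F] F) (v : V) (w : W) :
    contractRight g (v ⊗ₜ[F] w) = g w • v := by
  simp [contractRight]

/-- If a tensor is written with linearly independent factors, then the left factors of any other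
expression with the same number of terms lie in the span of the given left factors. -/
theorem left_mem_span_of_sum_tmul_eq [Fintype ι] {v v' : ι → V} {w w' : ι → W}
    (hv : LinearIndependent F v) (hw : LinearIndependent F w) {c c' : ι → F} (hc : ∀ a, c a ≠ 0)
    (h : ∑ a, c a • (v a ⊗ₜ[F] w a) = ∑ a, c' a • (v' a ⊗ₜ[F] w' a)) (a : ι) :
    v' a ∈ Submodule.span F (Set.range v) := by
  classical
  obtain ⟨g, hg⟩ := exists_dual_family hw
  -- Contracting with the functional dual to `w b` isolates `v b`; a dimension count then turns this
  -- inclusion into an equality.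
  have hle : Submodule.span F (Set.range v) ≤ Submodule.span F (Set.range v') := by
    refine Submodule.span_le.2 ?_
    rintro _ ⟨b, rfl⟩
    have h1 := congrArg (contractRight (g b)) h
    simp only [map_sum, map_smul, contractRight_tmul, hg, ite_smul, one_smul, zero_smul, smul_ite,
      smul_zero, Finset.sum_ite_eq, Finset.mem_univ, if_true] at h1
    have h2 : c b • v b ∈ Submodule.span F (Set.range v') := by
      rw [h1]
      exact Submodule.sum_mem _ fun i _ => Submodule.smul_mem _ _
        (Submodule.smul_mem _ _ (Submodule.subset_span ⟨i, rfl⟩))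
    exact (Submodule.smul_mem_iff _ (hc b)).1 h2
  have hfd : FiniteDimensional F (Submodule.span F (Set.range v')) :=
    FiniteDimensional.span_of_finite F (Set.finite_range _)
  rw [Submodule.eq_of_le_of_finrank_le hle
    ((finrank_range_le_card v').trans (finrank_span_eq_card hv).ge)]
  exact Submodule.subset_span ⟨a, rfl⟩

/-- If all members of a pencil vanish in turn, the left factors of the two decompositions are
proportional. -/
theorem left_mem_span_singleton_of_pencil_eq [Fintype ι] [DecidableEq ι] {v v' : ι → V}
    {w w' : ι → W} (hcard : 2 ≤ Fintype.card ι)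
    (hv : LinearIndependent F v) (hw : LinearIndependent F w)
    {c : ι → ι → F} (hc : ∀ a b, a ≠ b → c b a ≠ 0) (hc0 : ∀ b, c b b = 0)
    (h : ∀ b, ∑ a, c b a • (v a ⊗ₜ[F] w a) = ∑ a, c b a • (v' a ⊗ₜ[F] w' a)) (a : ι) :
    ∃ l : F, v' a = l • v a := by
  obtain ⟨g, hg⟩ := exists_dual_family hv
  -- Combination `b` loses exactly the term `b`. Intersecting these spans over all `b ≠ a` leaves
  -- only the line of `v a`.
  have hmem : ∀ b, a ≠ b → v' a ∈ Submodule.span F (Set.range fun i : {i // i ≠ b} => v i) := by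
    intro b hab
    have hsub : ∀ t : ι → V ⊗[F] W, ∑ i, c b i • t i = ∑ i : {i // i ≠ b}, c b i • t i := by
      intro t
      rw [← Finset.add_sum_erase _ _ (Finset.mem_univ b), hc0, zero_smul, zero_add]
      exact (Finset.sum_subtype _ (by simp) _)
    have h1 := h b
    rw [hsub, hsub] at h1
    exact left_mem_span_of_sum_tmul_eq (ι := {i // i ≠ b})
      (v := fun i => v i) (w := fun i => w i) (v' := fun i => v' i)
      (w' := fun i => w' i) (c := fun i => c b i)
      (hv.comp _ Subtype.val_injective) (hw.comp _ Subtype.val_injective)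
      (fun i => hc i b i.2) h1 ⟨a, hab⟩
  obtain ⟨b₀, hb₀⟩ := Fintype.exists_ne_of_one_lt_card (by omega) a
  have hspan : v' a ∈ Submodule.span F (Set.range v) :=
    Submodule.span_mono (by rintro _ ⟨i, rfl⟩; exact ⟨i, rfl⟩) (hmem b₀ hb₀.symm)
  have hzero : ∀ b, b ≠ a → g b (v' a) = 0 := by
    intro b hb
    have hle : Submodule.span F (Set.range fun i : {i // i ≠ b} => v i) ≤ (g b).ker := by
      refine Submodule.span_le.2 ?_
      rintro _ ⟨i, rfl⟩
      simp [hg, i.2.symm]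
    exact hle (hmem b hb.symm)
  refine ⟨g a (v' a), (eq_sum_of_mem_span hg hspan).trans ?_⟩
  exact Finset.sum_eq_single a (fun b _ hb => by rw [hzero b hb, zero_smul]) (by simp)

/-- Two linear combinations `∑ p_a v_a ⊗ w_a` and `∑ q_a v_a ⊗ w_a`, with pairwise non-proportional
coefficients and linearly independent factors, determine the terms `v_a ⊗ w_a`. -/
theorem tmul_eq_of_pencil_eq [Fintype ι] {v v' : ι → V}
    {w w' : ι → W} (hcard : 2 ≤ Fintype.card ι)
    (hv : LinearIndependent F v) (hw : LinearIndependent F w)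
    {p q : ι → F} (hpq : ∀ a b, a ≠ b → q b * p a - p b * q a ≠ 0)
    (hp : ∑ a, p a • (v a ⊗ₜ[F] w a) = ∑ a, p a • (v' a ⊗ₜ[F] w' a))
    (hq : ∑ a, q a • (v a ⊗ₜ[F] w a) = ∑ a, q a • (v' a ⊗ₜ[F] w' a)) (a : ι) :
    v a ⊗ₜ[F] w a = v' a ⊗ₜ[F] w' a := by
  classical
  -- The member of the pencil in which term `b` cancels.
  set c : ι → ι → F := fun b a => q b * p a - p b * q a with hc
  have hsum : ∀ b, ∑ a, c b a • (v a ⊗ₜ[F] w a) = ∑ a, c b a • (v' a ⊗ₜ[F] w' a) := by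
    intro b
    simp only [hc, sub_smul, mul_smul, Finset.sum_sub_distrib, ← Finset.smul_sum, hp, hq]
  have hsum' : ∀ b, ∑ a, c b a • (w a ⊗ₜ[F] v a) = ∑ a, c b a • (w' a ⊗ₜ[F] v' a) := by
    intro b
    simpa using congrArg (TensorProduct.comm F V W) (hsum b)
  have hc0 : ∀ b, c b b = 0 := fun b => by simp only [hc]; ring
  choose l hl using left_mem_span_singleton_of_pencil_eq hcard hv hw hpq hc0 hsum
  choose k hk using left_mem_span_singleton_of_pencil_eq hcard hw hv hpq hc0 hsum'
  obtain ⟨b, hb⟩ := Fintype.exists_ne_of_one_lt_card (by omega) a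
  obtain ⟨g, hg⟩ := exists_dual_family hv
  obtain ⟨g', hg'⟩ := exists_dual_family hw
  -- Comparing the coefficient of `v a ⊗ w a` shows that the two scaling factors multiply to one.
  have h1 := congrArg (fun t => g a (contractRight (g' a) t)) (hsum b)
  simp only [hl, hk, TensorProduct.smul_tmul_smul, map_sum, map_smul, contractRight_tmul, hg, hg',
    smul_eq_mul, mul_one, ite_smul, one_smul, zero_smul, smul_ite, smul_zero,
    Finset.sum_ite_eq, Finset.mem_univ, if_true] at h1
  have h2 : l a * k a = 1 := by
    refine mul_left_cancel₀ (hpq a b hb.symm) (Eq.trans h1.symm ?_)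
    rw [mul_one]
  rw [hl, hk, TensorProduct.smul_tmul_smul, h2, one_smul]

end Pencil

/-! ### Uniqueness from Condition U and the echelon condition -/

section Uniqueness

variable {F V₁ V₂ V₃ : Type*} [Field F] [AddCommGroup V₁] [Module F V₁]
  [AddCommGroup V₂] [Module F V₂] [AddCommGroup V₃] [Module F V₃]

/-- Contraction of the first factor of `V₁ ⊗ V₂ ⊗ V₃` with a functional. -/
def contractFirst (f : V₁ →ₗ[F] F) : V₁ ⊗[F] V₂ ⊗[F] V₃ →ₗ[F] V₂ ⊗[F] V₃ :=
  LinearMap.rTensor V₃ ((TensorProduct.lid F V₂).toLinearMap ∘ₗ LinearMap.rTensor V₂ f)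

@[simp]
theorem contractFirst_tmul (f : V₁ →ₗ[F] F) (v₁ : V₁) (v₂ : V₂) (v₃ : V₃) :
    contractFirst f (v₁ ⊗ₜ[F] v₂ ⊗ₜ[F] v₃) = f v₁ • (v₂ ⊗ₜ[F] v₃) := by
  simp [contractFirst, TensorProduct.smul_tmul']

theorem tensorRank₂_sum_smul_le {n : ℕ} (c : Fin n → F) (v : Fin n → V₂) (w : Fin n → V₃)
    [DecidablePred fun a => c a ≠ 0] :
    tensorRank₂ (∑ a, c a • (v a ⊗ₜ[F] w a)) ≤ (Finset.univ.filter fun a => c a ≠ 0).card := by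
  have h : ∑ a, c a • (v a ⊗ₜ[F] w a) =
      ∑ a ∈ Finset.univ.filter fun a => c a ≠ 0, (c a • v a) ⊗ₜ[F] w a := by
    rw [Finset.sum_filter]
    refine Finset.sum_congr rfl fun a _ => ?_
    split_ifs with ha
    · rw [TensorProduct.smul_tmul']
    · rw [not_not.1 ha, zero_smul]
  rw [h]
  exact tensorRank₂_sum_le _ _ _

theorem dimSpan_le_card {n : ℕ} (x : Fin n → V₁) : dimSpan F x ≤ n :=
  (finrank_range_le_card x).trans (Fintype.card_fin n).le

theorem two_le_dimSpan {n : ℕ} {x : Fin n → V₁} (h : 2 ≤ kRank F x) : 2 ≤ dimSpan F x := by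
  obtain ⟨hc, hind⟩ := (two_le_kRank_iff x).1 h
  rw [Fintype.card_fin] at hc
  have h1 := finrank_span_eq_card (hind ⟨0, by omega⟩ ⟨1, by omega⟩ (by simp))
  rw [Fintype.card_fin] at h1
  have hfd : FiniteDimensional F (Submodule.span F (Set.range x)) :=
    FiniteDimensional.span_of_finite F (Set.finite_range _)
  refine h1.symm.le.trans (Submodule.finrank_mono (Submodule.span_mono ?_))
  rintro _ ⟨i, rfl⟩
  fin_cases i
  · exact ⟨_, rfl⟩
  · exact ⟨_, rfl⟩

/-- Under Condition U, the first factors of any decomposition of the same tensor agree with the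
given ones up to order and scaling. -/
theorem ConditionU.exists_perm {n : ℕ} {x₁ y₁ : Fin n → V₁} {x₂ y₂ : Fin n → V₂}
    {x₃ y₃ : Fin n → V₃} (hU : ConditionU (F := F) x₁ x₂ x₃)
    (h : ∀ f : V₁ →ₗ[F] F, ∑ a, f (x₁ a) • (x₂ a ⊗ₜ[F] x₃ a) =
      ∑ a, f (y₁ a) • (y₂ a ⊗ₜ[F] y₃ a)) :
    ∃ σ : Equiv.Perm (Fin n), ∀ j, ∃ c : F, c ≠ 0 ∧ y₁ j = c • x₁ (σ j) := by
  classical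
  have hd := two_le_dimSpan hU.1
  have hdn := dimSpan_le_card (F := F) x₁
  have key : ∀ f : V₁ →ₗ[F] F,
      min (Finset.univ.filter fun a => f (x₁ a) ≠ 0).card (n - dimSpan F x₁ + 2) ≤
        (Finset.univ.filter fun a => f (y₁ a) ≠ 0).card := by
    intro f
    have h1 := hU.2 fun a => f (x₁ a)
    rw [h f] at h1
    have h2 := h1.trans (tensorRank₂_sum_smul_le _ _ _)
    have h3 : Function.support (fun a => f (x₁ a)) =
        ((Finset.univ.filter fun a => f (x₁ a) ≠ 0 : Finset (Fin n)) : Set (Fin n)) := by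
      ext a
      simp
    rwa [h3, Set.ncard_coe_finset] at h2
  refine exists_perm_of_card_hyperplane_le x₁ y₁ ((two_le_kRank_iff x₁).1 hU.1).2 hd
    (fun a => ?_) fun f hf => ?_
  · by_contra ha
    obtain ⟨f, hfa, hf⟩ := Submodule.exists_le_ker_of_notMem ha
    have h1 := key f
    have h2 : (Finset.univ.filter fun b => f (y₁ b) ≠ 0) = ∅ := by
      rw [Finset.filter_eq_empty_iff]
      intro b _
      exact not_not.2 (hf (Submodule.subset_span ⟨b, rfl⟩))
    have h3 : 0 < (Finset.univ.filter fun b => f (x₁ b) ≠ 0).card :=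
      Finset.card_pos.2 ⟨a, by simp [hfa]⟩
    rw [h2, Finset.card_empty] at h1
    omega
  · have h1 := key f
    have hx := Finset.card_filter_add_card_filter_not (s := Finset.univ) (fun a => f (x₁ a) = 0)
    have hy := Finset.card_filter_add_card_filter_not (s := Finset.univ) (fun a => f (y₁ a) = 0)
    rw [Finset.card_univ, Fintype.card_fin] at hx hy
    simp only [ne_eq] at h1
    omega

theorem card_subtype_le_val {n k : ℕ} (hk : k ≤ n) :
    Fintype.card {j : Fin n // k ≤ (j : ℕ)} = n - k := by
  rw [Fintype.card_subtype]
  have h := Finset.card_filter_add_card_filter_not (s := Finset.univ)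
    (fun j : Fin n => (j : ℕ) < k)
  rw [Fin.card_filter_val_lt, min_eq_right hk, Finset.card_univ, Fintype.card_fin] at h
  simp only [not_lt] at h
  omega

/-- The row operations leading to a reduced row echelon form, as a linear map on `V₁`. -/
theorem exists_linearMap_eq_columns {n m : ℕ} {x₁ : Fin n → V₁} {e : Fin m → V₁}
    (he : LinearIndependent F e) {X : Matrix (Fin m) (Fin n) F}
    (hX : ∀ a, x₁ a = ∑ i, X i a • e i) {τ : Equiv.Perm (Fin n)} {Y : Matrix (Fin m) (Fin n) F}
    (hY : IsReducedRowEchelonFormOf Y (X.submatrix id τ)) :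
    ∃ φ : V₁ →ₗ[F] (Fin m → F), ∀ j i, φ (x₁ (τ j)) i = Y i j := by
  obtain ⟨-, P, -, hP⟩ := hY
  obtain ⟨g, hg⟩ := exists_dual_family he
  refine ⟨P.mulVecLin ∘ₗ LinearMap.pi g, fun j i => ?_⟩
  have h1 : LinearMap.pi g (x₁ (τ j)) = fun i => X i (τ j) := by
    ext i
    simp [hX, hg]
  rw [LinearMap.comp_apply, h1, ← hP]
  rfl

/-- Under Condition U and the echelon condition, the first factors determine the remaining
factors. -/
theorem ConditionU.tmul_eq {n m : ℕ} {x₁ : Fin n → V₁} {x₂ y₂ : Fin n → V₂}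
    {x₃ y₃ : Fin n → V₃} (hU : ConditionU (F := F) x₁ x₂ x₃) {e : Fin m → V₁}
    (he : LinearIndependent F e) {X : Matrix (Fin m) (Fin n) F}
    (hX : ∀ a, x₁ a = ∑ i, X i a • e i) (hE : EchelonCondition (dimSpan F x₁) X)
    (h : ∀ f : V₁ →ₗ[F] F, ∑ a, f (x₁ a) • (x₂ a ⊗ₜ[F] x₃ a) =
      ∑ a, f (x₁ a) • (y₂ a ⊗ₜ[F] y₃ a)) (a : Fin n) :
    x₂ a ⊗ₜ[F] x₃ a = y₂ a ⊗ₜ[F] y₃ a := by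
  have hd := two_le_dimSpan hU.1
  have hdn := dimSpan_le_card (F := F) x₁
  have hdm : dimSpan F x₁ ≤ m := by
    have hfd : FiniteDimensional F (Submodule.span F (Set.range e)) :=
      FiniteDimensional.span_of_finite F (Set.finite_range _)
    refine le_trans (Submodule.finrank_mono (Submodule.span_le.2 ?_)) (dimSpan_le_card (F := F) e)
    rintro _ ⟨a, rfl⟩
    rw [hX]
    exact Submodule.sum_mem _ fun i _ => Submodule.smul_mem _ _ (Submodule.subset_span ⟨i, rfl⟩)
  obtain ⟨τ, Y, hY, hI, -, hk⟩ := hE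
  obtain ⟨φ, hφ⟩ := exists_linearMap_eq_columns he hX hY
  have hrank := hU.2
  generalize dimSpan F x₁ = d at *
  -- Rows `s` and `s + 1` are the last two nonzero rows; they vanish before column `s`, leaving `n -
  -- s = n - d + 2` columns.
  obtain ⟨s, rfl⟩ : ∃ s, d = s + 2 := ⟨d - 2, by omega⟩
  have hrow : ∀ i : Fin m, ∑ j, Y i j • (x₂ (τ j) ⊗ₜ[F] x₃ (τ j)) =
      ∑ j, Y i j • (y₂ (τ j) ⊗ₜ[F] y₃ (τ j)) := by
    intro i
    have h1 := h (LinearMap.proj i ∘ₗ φ)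
    rw [← Equiv.sum_comp τ, ← Equiv.sum_comp τ (fun a => _ • (y₂ a ⊗ₜ[F] y₃ a))] at h1
    simpa only [LinearMap.comp_apply, LinearMap.proj_apply, hφ] using h1
  have hsub : ∀ (c : Fin n → F) (t : Fin n → V₂ ⊗[F] V₃), (∀ j : Fin n, (j : ℕ) < s → c j = 0) →
      ∑ j, c j • t j = ∑ j : {j : Fin n // s ≤ (j : ℕ)}, c j • t j := by
    intro c t hc
    rw [← Finset.sum_subtype (Finset.univ.filter fun j : Fin n => s ≤ (j : ℕ)) (by simp)
      (fun j => c j • t j), Finset.sum_filter_of_ne]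
    intro j _ hj
    by_contra hlt
    exact hj (by rw [hc j (by omega), zero_smul])
  have hcardκ : Fintype.card {j : Fin n // s ≤ (j : ℕ)} = n - (s + 2) + 2 := by
    rw [card_subtype_le_val (by omega)]
    omega
  have hrk : Fintype.card {j : Fin n // s ≤ (j : ℕ)} ≤
      tensorRank₂ (∑ j : {j : Fin n // s ≤ (j : ℕ)}, x₂ (τ j) ⊗ₜ[F] x₃ (τ j)) := by
    -- For the indicator of these columns both entries of the minimum equal `n - s`, so the rank
    -- bound is the number of terms.
    have h1 := hrank fun a => if s ≤ (τ.symm a : ℕ) then 1 else 0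
    have h2 : (Function.support fun a => if s ≤ (τ.symm a : ℕ) then (1 : F) else 0).ncard =
        Fintype.card {j : Fin n // s ≤ (j : ℕ)} := by
      have h3 : (Function.support fun a => if s ≤ (τ.symm a : ℕ) then (1 : F) else 0) =
          τ '' {j : Fin n | s ≤ (j : ℕ)} := by
        ext a
        simp [Equiv.image_eq_preimage_symm]
      rw [h3, Set.ncard_image_of_injective _ τ.injective, ← Nat.card_coe_set_eq,
        Nat.card_eq_fintype_card]
      rfl
    rw [h2, hcardκ, min_self, ← Equiv.sum_comp τ,
      hsub (fun j => if s ≤ (τ.symm (τ j) : ℕ) then (1 : F) else 0)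
        (fun j => x₂ (τ j) ⊗ₜ[F] x₃ (τ j)) (by simp)] at h1
    rw [hcardκ]
    convert h1 using 3 with j
    simp [j.2]
  have hpair := ((two_le_kRank_iff _).1 (hk s (by omega))).2
  set i₀ : Fin m := ⟨s, by omega⟩ with hi₀
  set i₁ : Fin m := ⟨s + 1, by omega⟩ with hi₁
  have hrows : ∀ i : {i : Fin m // s ≤ (i : ℕ) ∧ (i : ℕ) < s + 2}, i.1 = i₀ ∨ i.1 = i₁ := by
    rintro ⟨i, hi⟩
    simp only [hi₀, hi₁, Fin.ext_iff]
    omega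
  have hlow : ∀ i : Fin m, s ≤ (i : ℕ) → ∀ j : Fin n, (j : ℕ) < s → Y i j = 0 := by
    intro i hi j hj
    rw [hI i j (by omega), if_neg (by omega)]
  have hS : ∀ j : {j : Fin n // s ≤ (j : ℕ)},
      x₂ (τ j) ⊗ₜ[F] x₃ (τ j) = y₂ (τ j) ⊗ₜ[F] y₃ (τ j) := by
    refine tmul_eq_of_pencil_eq (v := fun j : {j : Fin n // s ≤ (j : ℕ)} => x₂ (τ j))
      (w := fun j => x₃ (τ j)) (v' := fun j => y₂ (τ j)) (w' := fun j => y₃ (τ j))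
      (p := fun j => Y i₀ j) (q := fun j => Y i₁ j)
      (by rw [hcardκ]; omega) (linearIndependent_left_of_card_le_tensorRank₂ _ _ hrk)
      (linearIndependent_right_of_card_le_tensorRank₂ _ _ hrk) (fun a b hab hdet => ?_) ?_ ?_
    · have hab' := LinearIndependent.pair_iff.1 (hpair a b hab)
      -- A vanishing determinant makes each row's entries a relation between columns `a` and `b`;
      -- independence then kills column `a`, which is absurd.
      have h1 := hab' (Y i₁ b) (-Y i₁ a) (by
        ext i
        simp only [Pi.add_apply, Pi.smul_apply, smul_eq_mul, Pi.zero_apply]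
        rcases hrows i with hi | hi <;> rw [hi]
        · linear_combination hdet
        · ring)
      have hq : Y i₁ a = 0 := neg_eq_zero.1 h1.2
      have h2 := hab' (Y i₀ b) (-Y i₀ a) (by
        ext i
        simp only [Pi.add_apply, Pi.smul_apply, smul_eq_mul, Pi.zero_apply]
        rcases hrows i with hi | hi <;> rw [hi]
        · ring
        · rw [hq, h1.1]; ring)
      have hp : Y i₀ a = 0 := neg_eq_zero.1 h2.2
      refine one_ne_zero (hab' 1 0 ?_).1
      ext i
      simp only [Pi.add_apply, Pi.smul_apply, smul_eq_mul, Pi.zero_apply]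
      rcases hrows i with hi | hi <;> rw [hi] <;> simp [hp, hq]
    · have h1 := hrow i₀
      rwa [hsub _ _ (hlow i₀ le_rfl), hsub _ _ (hlow i₀ le_rfl)] at h1
    · have h1 := hrow i₁
      rwa [hsub _ _ (hlow i₁ (by simp [hi₁])), hsub _ _ (hlow i₁ (by simp [hi₁]))] at h1
  obtain ⟨j, rfl⟩ := τ.surjective a
  by_cases hj : s ≤ (j : ℕ)
  · exact hS ⟨j, hj⟩
  -- Row `j` has coefficient one at `j` and zero at the other columns before `s`; the columns from
  -- `s` on are settled, so only term `j` remains.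
  · have h1 := hrow ⟨j, by omega⟩
    rw [← Finset.add_sum_erase _ _ (Finset.mem_univ j),
      ← Finset.add_sum_erase _ (fun j' => _ • (y₂ (τ j') ⊗ₜ[F] y₃ (τ j'))) (Finset.mem_univ j),
      hI _ j (by omega), if_pos rfl, one_smul, one_smul] at h1
    refine add_right_cancel (h1.trans (congrArg _ (Finset.sum_congr rfl fun k hk' => ?_)))
    by_cases hks : s ≤ (k : ℕ)
    · rw [hS ⟨k, hks⟩]
    · have hne : (j : ℕ) ≠ k := fun h => Finset.ne_of_mem_erase hk' (Fin.ext h.symm)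
      rw [hI _ k (by omega), if_neg hne, zero_smul, zero_smul]

/-- Condition U and the echelon condition imply uniqueness of the tensor rank decomposition. -/
theorem ConditionU.isUniqueTensorRankDecomposition {n m : ℕ} {x₁ : Fin n → V₁} {x₂ : Fin n → V₂}
    {x₃ : Fin n → V₃} (hx : ∀ a, x₁ a ⊗ₜ[F] x₂ a ⊗ₜ[F] x₃ a ≠ 0)
    (hU : ConditionU (F := F) x₁ x₂ x₃) {e : Fin m → V₁}
    (he : LinearIndependent F e) {X : Matrix (Fin m) (Fin n) F}
    (hX : ∀ a, x₁ a = ∑ i, X i a • e i) (hE : EchelonCondition (dimSpan F x₁) X) :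
    IsUniqueTensorRankDecomposition (fun a => x₁ a ⊗ₜ[F] x₂ a ⊗ₜ[F] x₃ a) := by
  refine ⟨fun a => ⟨hx a, _, _, _, rfl⟩, fun r y hr hy hxy => ?_⟩
  choose hy0 y₁ y₂ y₃ hy' using hy
  have hcontr : ∀ f : V₁ →ₗ[F] F, ∑ a, f (x₁ a) • (x₂ a ⊗ₜ[F] x₃ a) =
      ∑ a, f (y₁ a) • (y₂ a ⊗ₜ[F] y₃ a) := by
    intro f
    simpa [hy'] using congrArg (contractFirst f) hxy
  have hx0 : ∀ a, x₁ a ≠ 0 := fun a ha => hx a (by simp [ha])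
  have hrn : r = n := by
    by_contra hne
    obtain ⟨k, rfl⟩ : ∃ k, n = r + k := ⟨n - r, by omega⟩
    -- Padding a shorter decomposition with zeros would make a zero vector a nonzero multiple of
    -- some `x₁ a`.
    obtain ⟨σ, hσ⟩ := hU.exists_perm (y₁ := Fin.append y₁ fun _ => 0)
      (y₂ := Fin.append y₂ fun _ => 0) (y₃ := Fin.append y₃ fun _ => 0) (fun f => by
        rw [hcontr f, Fin.sum_univ_add]
        simp)
    obtain ⟨c, hc, h⟩ := hσ (Fin.natAdd r ⟨0, by omega⟩)
    rw [Fin.append_right] at h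
    exact smul_ne_zero hc (hx0 _) h.symm
  subst hrn
  obtain ⟨σ, hσ⟩ := hU.exists_perm hcontr
  choose c hc hyx using hσ
  -- Moving the scalars into the second factors and reindexing makes the first factors literally
  -- equal.
  have heq := hU.tmul_eq (y₂ := fun a => c (σ.symm a) • y₂ (σ.symm a))
    (y₃ := fun a => y₃ (σ.symm a)) he hX hE (fun f => by
      rw [hcontr f, ← Equiv.sum_comp σ (fun a => f (x₁ a) • _)]
      refine Finset.sum_congr rfl fun j _ => ?_
      rw [hyx, Equiv.symm_apply_apply, map_smul, ← TensorProduct.smul_tmul', smul_smul,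
        smul_eq_mul, mul_comm])
  have hxσ : (fun a => x₁ a ⊗ₜ[F] x₂ a ⊗ₜ[F] x₃ a) ∘ σ = y := by
    ext j
    refine (TensorProduct.assoc F V₁ V₂ V₃).injective ?_
    rw [Function.comp_apply, hy', hyx, TensorProduct.assoc_tmul, TensorProduct.assoc_tmul, heq]
    simp only [Equiv.symm_apply_apply]
    rw [← TensorProduct.smul_tmul', TensorProduct.tmul_smul, TensorProduct.smul_tmul']
  refine ⟨rfl, ?_⟩
  rw [← hxσ, ← Multiset.map_map, Multiset.map_univ_val_equiv]

end Uniqueness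

/-! ### Echelon condition versus invariant condition -/

section Echelon

variable {F V : Type*} [Field F] [AddCommGroup V] [Module F V]

/-- The operator row-reduces, keeps rows `a, …, d - 1` and re-embeds them in `V` through `e`; the
embedding is injective, so pairwise independence survives. -/
theorem InvariantCondition.of_echelonCondition {n m : ℕ} {x : Fin n → V} {e : Fin m → V}
    (he : LinearIndependent F e) {X : Matrix (Fin m) (Fin n) F}
    (hX : ∀ a, x a = ∑ i, X i a • e i) (hE : EchelonCondition (dimSpan F x) X) :
    InvariantCondition (F := F) x := by
  obtain ⟨τ, Y, hY, hI, -, hk⟩ := hE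
  obtain ⟨φ, hφ⟩ := exists_linearMap_eq_columns he hX hY
  refine ⟨τ, fun a ha => ?_⟩
  set L := Fintype.linearCombination F
    (fun i : {i : Fin m // a ≤ (i : ℕ) ∧ (i : ℕ) < dimSpan F x} => e i)
  have hL : Function.Injective L :=
    linearIndependent_iff_injective_fintypeLinearCombination.1 (he.comp _ Subtype.val_injective)
  set T : V →ₗ[F] V := L ∘ₗ LinearMap.funLeft F F Subtype.val ∘ₗ φ with hT
  have hTx : ∀ j, T (x (τ j)) = L (fun i => Y i j) := by
    intro j
    rw [hT, LinearMap.comp_apply, LinearMap.comp_apply]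
    congr 1
    ext i
    rw [LinearMap.funLeft_apply, hφ]
  refine ⟨T, fun b hb => ?_, ?_⟩
  · rw [hTx, ← map_zero L]
    congr 1
    ext i
    rw [hI _ _ (by omega), if_neg (by have := i.2; omega), Pi.zero_apply]
  · obtain ⟨hc, hp⟩ := (two_le_kRank_iff _).1 (hk a ha)
    refine (two_le_kRank_iff _).2 ⟨hc, fun i j hij => ?_⟩
    rw [hTx, hTx]
    exact linearIndependent_pair_map L hL (hp i j hij)

/-- A linearly independent family in `F ^ m` is an initial segment of a basis. -/
theorem exists_basis_extending {d m : ℕ} (hdm : d ≤ m) {v : Fin d → Fin m → F}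
    (hv : LinearIndependent F v) :
    ∃ b : Module.Basis (Fin m) F (Fin m → F), ∀ i, b (Fin.castLE hdm i) = v i := by
  obtain ⟨k, rfl⟩ := Nat.exists_eq_add_of_le hdm
  have hfin : Finite (Fin d ⊕ Module.Basis.sumExtendIndex hv) :=
    Module.Finite.finite_basis (Module.Basis.sumExtend hv)
  have hfin' : Finite (Module.Basis.sumExtendIndex hv) :=
    Finite.of_injective (Sum.inr : _ → Fin d ⊕ _) Sum.inr_injective
  have hcard := Module.finrank_eq_nat_card_basis (Module.Basis.sumExtend hv)
  rw [Module.finrank_fin_fun, Nat.card_sum, Nat.card_fin] at hcard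
  let ε : Module.Basis.sumExtendIndex hv ≃ Fin k := Finite.equivFinOfCardEq (by omega)
  refine ⟨(Module.Basis.sumExtend hv).reindex
    ((Equiv.sumCongr (Equiv.refl _) ε).trans finSumFinEquiv), fun i => ?_⟩
  have hi : Fin.castLE hdm i = Fin.castAdd k i := rfl
  rw [hi]
  simp only [Module.Basis.sumExtend, Module.Basis.reindex_apply, Module.Basis.extend_apply_self,
    Equiv.symm_trans_apply, finSumFinEquiv_symm_apply_castAdd]
  rfl

/-- The invariant condition forces the first `d` vectors to be linearly independent. -/
theorem linearIndependent_initial {n : ℕ} {x : Fin n → V} (hx0 : ∀ a, x a ≠ 0)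
    {τ : Equiv.Perm (Fin n)} {d : ℕ} (hdn : d ≤ n)
    (hT : ∀ a : ℕ, a + 1 < d → ∃ T : V →ₗ[F] V,
      (∀ b : Fin n, (b : ℕ) < a → T (x (τ b)) = 0) ∧
      2 ≤ kRank F (fun j : {j : Fin n // a ≤ (j : ℕ)} => T (x (τ j)))) :
    LinearIndependent F (fun i : Fin d => x (τ (Fin.castLE hdn i))) := by
  have hnot : ∀ k (hk : k < d), x (τ ⟨k, by omega⟩) ∉
      Submodule.span F (Set.range fun i : Fin k => x (τ (Fin.castLE (by omega) i))) := by
    intro k hk hmem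
    rcases Nat.eq_zero_or_pos k with rfl | hpos
    · simp [hx0] at hmem
    -- This operator kills everything before position `k - 1`, so a dependence of vector `k` on its
    -- predecessors would make its image proportional to that of vector `k - 1`.
    obtain ⟨T, hker, hT⟩ := hT (k - 1) (by omega)
    have hind := ((two_le_kRank_iff _).1 hT).2 ⟨⟨k, by omega⟩, by simp⟩
      ⟨⟨k - 1, by omega⟩, le_rfl⟩ (by simp; omega)
    have hle : Submodule.span F (Set.range fun i : Fin k => x (τ (Fin.castLE (by omega) i))) ≤
        (Submodule.span F {T (x (τ ⟨k - 1, by omega⟩))}).comap T := by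
      refine Submodule.span_le.2 ?_
      rintro _ ⟨i, rfl⟩
      rw [SetLike.mem_coe, Submodule.mem_comap]
      rcases Nat.lt_or_ge i (k - 1) with hi | hi
      · have h0 := hker (Fin.castLE (by omega) i) hi
        simp only [h0, Submodule.zero_mem]
      · have h0 : (Fin.castLE (by omega) i : Fin n) = ⟨k - 1, by omega⟩ :=
          Fin.ext (by simp only [Fin.val_castLE]; omega)
        simp only [h0, Submodule.mem_span_singleton_self]
    obtain ⟨c, hc⟩ := Submodule.mem_span_singleton.1 (hle hmem)
    have := LinearIndependent.pair_iff.1 hind 1 (-c) (by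
      simp only [neg_smul, one_smul]
      rw [hc, add_neg_cancel])
    exact one_ne_zero this.1
  have hall : ∀ k (hk : k ≤ d),
      LinearIndependent F (fun i : Fin k => x (τ (Fin.castLE (hk.trans hdn) i))) := by
    intro k
    induction k with
    | zero => exact fun _ => linearIndependent_empty_type
    | succ k ih => exact fun hk => linearIndependent_finSucc'.2 ⟨ih (by omega), hnot k hk⟩
  exact hall d le_rfl

theorem EchelonCondition.of_invariantCondition {n m : ℕ} {x : Fin n → V} (hx0 : ∀ a, x a ≠ 0)
    {e : Fin m → V} (he : LinearIndependent F e) {X : Matrix (Fin m) (Fin n) F}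
    (hX : ∀ a, x a = ∑ i, X i a • e i) (hT : InvariantCondition (F := F) x) :
    EchelonCondition (dimSpan F x) X := by
  obtain ⟨τ, hT⟩ := hT
  have hdn := dimSpan_le_card (F := F) x
  have hdim : Module.finrank F (Submodule.span F (Set.range x)) = dimSpan F x := rfl
  generalize dimSpan F x = d at *
  have hind := linearIndependent_initial hx0 hdn hT
  set L := Fintype.linearCombination F e with hL
  have hLinj : Function.Injective L := linearIndependent_iff_injective_fintypeLinearCombination.1 he
  have hLX : ∀ a, L (fun i => X i a) = x a := by
    intro a
    rw [hX, hL, Fintype.linearCombination_apply]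
  have hindX : LinearIndependent F
      (fun (j : Fin d) (i : Fin m) => X i (τ (Fin.castLE hdn j))) := by
    refine LinearIndependent.of_comp L ?_
    convert hind using 1
    ext j
    exact hLX _
  have hdm : d ≤ m := by simpa using hindX.fintype_card_le_finrank
  obtain ⟨b, hb⟩ := exists_basis_extending hdm hindX
  have hspan : ∀ a, x a ∈ Submodule.span F
      (Set.range fun i : Fin d => x (τ (Fin.castLE hdn i))) := by
    have hfd : FiniteDimensional F (Submodule.span F (Set.range x)) :=
      FiniteDimensional.span_of_finite F (Set.finite_range _)
    intro a
    rw [Submodule.eq_of_le_of_finrank_le (S₂ := Submodule.span F (Set.range x))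
      (Submodule.span_mono (by rintro _ ⟨i, rfl⟩; exact ⟨_, rfl⟩))
      (by rw [hdim, finrank_span_eq_card hind, Fintype.card_fin])]
    exact Submodule.subset_span ⟨a, rfl⟩
  -- The change of coordinates to a basis beginning with the first `d` permuted columns.
  set P := LinearMap.toMatrixAlgEquiv' (b.equivFun : (Fin m → F) →ₗ[F] (Fin m → F)) with hP
  set Y := P * X.submatrix id τ with hYdef
  have hY : ∀ i j, Y i j = b.repr (fun i => X i (τ j)) i := by
    intro i j
    have h1 : Y i j = (P.mulVec fun i => X i (τ j)) i := rfl
    rw [h1, hP, ← Matrix.toLinAlgEquiv'_apply, Matrix.toLinAlgEquiv'_toMatrixAlgEquiv']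
    rfl
  have hI : ∀ (i : Fin m) (j : Fin n), (j : ℕ) < d →
      Y i j = if (i : ℕ) = (j : ℕ) then 1 else 0 := by
    intro i j hj
    have h1 : (fun i => X i (τ j)) = b (Fin.castLE hdm ⟨j, hj⟩) := (hb ⟨j, hj⟩).symm
    rw [hY, h1, b.repr_self, Finsupp.single_apply]
    simp [Fin.ext_iff, eq_comm]
  have hzero : ∀ (i : Fin m) (j : Fin n), d ≤ (i : ℕ) → Y i j = 0 := by
    intro i j hi
    obtain ⟨c, hc⟩ := (Submodule.mem_span_range_iff_exists_fun F).1 (hspan (τ j))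
    have h1 : (fun i => X i (τ j)) = ∑ k, c k • b (Fin.castLE hdm k) := by
      apply hLinj
      rw [hLX, ← hc, map_sum]
      refine Finset.sum_congr rfl fun k _ => ?_
      rw [map_smul, hb, hLX]
    rw [hY, h1, map_sum, Finsupp.finsetSum_apply]
    refine Finset.sum_eq_zero fun k _ => ?_
    have hne : Fin.castLE hdm k ≠ i := fun h => by
      have := congrArg Fin.val h
      simp only [Fin.val_castLE] at this
      omega
    simp [hne]
  refine ⟨τ, Y,
    ⟨⟨d, hdm, Fin.castLE hdn, Fin.strictMono_castLE hdn, ?_, ?_, ?_, hzero⟩, P, ?_, rfl⟩,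
    hI, hzero, fun a ha => ?_⟩
  · intro k
    rw [hI _ _ k.2]
    simp
  · intro k j hj
    have hj' : (j : ℕ) < k := hj
    rw [hI _ _ (by omega), if_neg]
    simp only [Fin.val_castLE]
    omega
  · intro k i hi
    rw [hI _ _ k.2, if_neg]
    exact fun h => hi (Fin.ext h)
  · exact ((Module.End.isUnit_iff _).2 b.equivFun.bijective).map LinearMap.toMatrixAlgEquiv'
  · obtain ⟨T, hker, hT⟩ := hT a ha
    obtain ⟨hc, hp⟩ := (two_le_kRank_iff _).1 hT
    refine (two_le_kRank_iff _).2 ⟨hc, fun j k hjk => ?_⟩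
    -- `ψ` recovers `T (x (τ j))` from the truncated column: `T` kills the contributions of rows
    -- before `a`, and rows from `d` on are zero. Independence of the images thus lifts to the
    -- columns.
    set ψ := Fintype.linearCombination F
      (fun i : {i : Fin m // a ≤ (i : ℕ) ∧ (i : ℕ) < d} => T (L (b i))) with hψ
    have hψY : ∀ j, ψ (fun i => Y i j) = T (x (τ j)) := by
      intro j
      rw [← hLX, ← b.sum_repr (fun i => X i (τ j)), map_sum, map_sum, hψ,
        Fintype.linearCombination_apply,
        ← Finset.sum_subtype (Finset.univ.filter fun i : Fin m => a ≤ (i : ℕ) ∧ (i : ℕ) < d)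
          (by simp) (fun i => Y i j • T (L (b i))), Finset.sum_filter_of_ne]
      · refine Finset.sum_congr rfl fun i _ => ?_
        rw [map_smul, map_smul, hY]
      · intro i _ hi
        have hid : (i : ℕ) < d := by
          by_contra h
          exact hi (by rw [hzero i j (by omega), zero_smul])
        refine ⟨?_, hid⟩
        by_contra h
        have h1 : b i = fun i' => X i' (τ (Fin.castLE hdn ⟨i, hid⟩)) := hb ⟨i, hid⟩
        refine hi ?_
        rw [h1, hLX, hker _ (by simp only [Fin.val_castLE]; omega), smul_zero]
    refine linearIndependent_pair_of_map ψ ?_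
    rw [hψY, hψY]
    exact hp j k hjk

end Echelon

end TensorUniqueness

end

theorem mainTheorem12 {F V₁ V₂ V₃ : Type*} [Field F]
    [AddCommGroup V₁] [Module F V₁] [AddCommGroup V₂] [Module F V₂]
    [AddCommGroup V₃] [Module F V₃] {n : ℕ}
    (x₁ : Fin n → V₁) (x₂ : Fin n → V₂) (x₃ : Fin n → V₃)
    (hx : ∀ a, x₁ a ⊗ₜ[F] x₂ a ⊗ₜ[F] x₃ a ≠ 0)
    -- `X` is the matrix of the first factors in coordinates with respect to `e`
    {m : ℕ} (e : Fin m → V₁) (he : LinearIndependent F e)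
    (X : Matrix (Fin m) (Fin n) F) (hX : ∀ a, x₁ a = ∑ i, X i a • e i) :
    (TensorUniqueness.EchelonCondition (TensorUniqueness.dimSpan F x₁) X ↔
      TensorUniqueness.InvariantCondition (F := F) x₁) ∧
    (TensorUniqueness.ConditionU (F := F) x₁ x₂ x₃ →
      TensorUniqueness.EchelonCondition (TensorUniqueness.dimSpan F x₁) X →
      TensorUniqueness.IsUniqueTensorRankDecomposition
        (fun a => x₁ a ⊗ₜ[F] x₂ a ⊗ₜ[F] x₃ a)) := by
  refine ⟨⟨TensorUniqueness.InvariantCondition.of_echelonCondition he hX,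
    TensorUniqueness.EchelonCondition.of_invariantCondition (fun a ha => hx a ?_) he hX⟩,
    fun hU hE => hU.isUniqueTensorRankDecomposition hx he hX hE⟩
  rw [ha, TensorProduct.zero_tmul, TensorProduct.zero_tmul]
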